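/- Let $\mathbb{Z}[i]$ be the ring of Gaussian integers and $\mathbb{Q}(i)=\{\omega/\gamma:\omega,\gamma\in\mathbb{Z}[i],\ \gamma\neq 0\}\subset\mathbb{C}$ the set of Gaussian rational numbers. Let $\beta\in\mathbb{Z}[i]$ with $|\beta|>1$, let $D\subset\mathbb{Q}(i)$ be a finite set, and let $$K_{\beta,D}=\Big\{\sum_{j=1}^{\infty}\frac{d_j}{\beta^j}: d_j\in D \text{ for all } j\ge 1\Big\}\subset\mathbb{C}.$$ Let $\mathcal{S}$ be a finite set of pairwise non-associate prime elements of $\mathbb{Z}[i]$, none of which divides $\beta$. Suppose that the Hausdorff dimension of $K_{\beta,D}$ is less than $1$. Then $K_{\beta,D}$ contains only finitely many numbers that can be written as $\omega/\gamma$ with $\omega,\gamma\in\mathbb{Z}[i]$, $\gamma\neq 0$, such that every prime factor of $\gamma$ in $\mathbb{Z}[i]$ is an associate of an element of $\mathcal{S}$. -/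

import Mathlib

/-- The set `ℚ(i)` of Gaussian rational numbers `ω / γ` (`ω, γ ∈ ℤ[i]`, `γ ≠ 0`), as a subset
of `ℂ`. -/
def gaussianRationals : Set ℂ :=
  {z | ∃ ω γ : GaussianInt, γ ≠ 0 ∧ z = (ω : ℂ) / (γ : ℂ)}

/-- The set `K_{β,D}` of all sums `∑_{j ≥ 1} d_j / β ^ j` with digits `d_j ∈ D`
(the digit `d_{j+1}` is written `d j`, so that the index runs over `ℕ`). -/
def selfSimilarSet (β : GaussianInt) (D : Set ℂ) : Set ℂ :=
  {z | ∃ d : ℕ → ℂ, (∀ j, d j ∈ D) ∧ HasSum (fun j : ℕ => d j / (β : ℂ) ^ (j + 1)) z}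

/-- The Gaussian rational numbers `ω / γ` whose denominator `γ ≠ 0` has all its prime factors
in `S`, up to multiplication by units; `ω / γ` need not be in lowest terms. -/
def gaussianRationalsWithDenomIn (S : Set GaussianInt) : Set ℂ :=
  {z | ∃ ω γ : GaussianInt, γ ≠ 0 ∧
    (∀ π : GaussianInt, Prime π → π ∣ γ → ∃ σ ∈ S, Associated π σ) ∧
    z = (ω : ℂ) / (γ : ℂ)}

/-!
Write `K` for the self-similar set and let `q` be a common denominator of the digits. The shift
of digits shows that `β K ⊆ K + q⁻¹ ℤ[i]`, so `K` is invariant under multiplication by `β` on the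
torus `ℂ / q⁻¹ ℤ[i]`. The orbit of a point `ω / γ` of `K` in lowest terms is compared with the
size of `K` in two ways.

*Upper bound.* Choose `t` with `dimH K < t < 1`. For invariant sets of an expanding map of the
torus, box dimension and Hausdorff dimension agree. The part needed here is that `K` contains
only `O(ρ ^ (-t))` points that are `ρ`-separated on the torus
(`IsCompact.exists_card_le_rpow_of_invariant`): each piece of a cover of `K` with small `t`-sum
is expanded by a power of `β` to a fixed size, which yields a recursive inequality in `ρ`.

*Lower bound.* The points `β ^ n * (ω / γ)` have denominator `q γ`, so distinct ones are
`|q γ|⁻¹`-separated (`GaussianInt.le_norm_sub_sub_of_orbit`). If two of them agree at times that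
differ by `k`, then `γ ∣ q * (β ^ k - 1)`. After `β` is replaced by a power `α ≡ 1` modulo a
suitable modulus, a form of "lifting the exponent" (`dvd_mul_natCast_of_dvd_pow_sub_one`) gives
`γ ∣ q * (α - 1) * k`, and hence `|γ| ≤ C k` (`GaussianInt.exists_norm_le_mul_order`). So the
orbit has at least `|γ| / C` points.

Together `|γ| / C ≤ A * |γ| ^ t` with `t < 1`, which bounds `|γ|`. As `K` is bounded, this leaves
only finitely many `ω / γ`.
-/

open scoped NNReal ENNReal
open MeasureTheory

/-! ### Smooth elements of a principal ideal domain -/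

section Smooth

variable {R : Type*} [CommRing R]

/-- An element is `S`-smooth when each of its prime divisors is associated to an element
of `S`. -/
def IsSmoothOver (S : Set R) (γ : R) : Prop :=
  ∀ π : R, Prime π → π ∣ γ → ∃ σ ∈ S, Associated π σ

theorem IsSmoothOver.of_dvd {S : Set R} {γ δ : R} (h : IsSmoothOver S γ) (hd : δ ∣ γ) :
    IsSmoothOver S δ := fun π hπ hπδ => h π hπ (hπδ.trans hd)

theorem IsSmoothOver.mul {S : Set R} {γ δ : R} (hγ : IsSmoothOver S γ) (hδ : IsSmoothOver S δ) :
    IsSmoothOver S (γ * δ) := fun π hπ h =>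
  (hπ.dvd_or_dvd h).elim (hγ π hπ) (hδ π hπ)

theorem IsSmoothOver.of_isUnit {S : Set R} {u : R} (hu : IsUnit u) : IsSmoothOver S u :=
  fun _ hπ h => (hπ.not_isUnit (isUnit_of_dvd_unit h hu)).elim

/-- A prime lies above at most one rational prime. -/
theorem eq_of_prime_dvd_natCast {π : R} (hπ : Prime π) {p q : ℕ} (hp : p.Prime) (hq : q.Prime)
    (h : π ∣ (p : R)) (h' : π ∣ (q : R)) : p = q := by
  by_contra hne
  have hc : IsCoprime (p : R) (q : R) := by
    simpa using ((Nat.isCoprime_iff_coprime.2 ((Nat.coprime_primes hp hq).2 hne)).map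
      (Int.castRingHom R))
  exact hπ.not_isUnit (hc.isUnit_of_dvd' h h')

/-- A divisibility form of "lifting the exponent": for `α ≡ 1` modulo the modulus of
`exists_smooth_modulus` below, the smooth part of `α ^ k - 1` divides `(α - 1) * k`. The induction
runs over the prime factors `p` of `k`, where
`α ^ p - 1 = (α - 1) * ∑ j < p, α ^ j` and the sum is congruent to `p`. -/
theorem dvd_mul_natCast_of_dvd_pow_sub_one {S : Set R} {B : R}
    (hB : ∀ p : ℕ, p.Prime → ∀ x : R, B ∣ x - p →
      ∀ γ : R, γ ≠ 0 → IsSmoothOver S γ → ∀ a, γ ∣ a * x → γ ∣ a * p)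
    {γ : R} (hγ0 : γ ≠ 0) (hγ : IsSmoothOver S γ) (k : ℕ) :
    ∀ a α : R, B ∣ α - 1 → γ ∣ a * (α ^ k - 1) → γ ∣ a * (α - 1) * k := by
  induction k using induction_on_primes with
  | zero => simp
  | one => simp
  | prime_mul p k hp ih =>
    intro a α hα h
    have hα' : B ∣ α ^ p - 1 := hα.trans (sub_one_dvd_pow_sub_one α p)
    rw [pow_mul] at h
    have h1 := ih a (α ^ p) hα' h
    rw [← mul_geom_sum] at h1
    have hx : B ∣ (∑ j ∈ Finset.range p, α ^ j) - (p : R) := by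
      have : (∑ j ∈ Finset.range p, α ^ j) - (p : R) = ∑ j ∈ Finset.range p, (α ^ j - 1) := by
        simp
      rw [this]
      exact Finset.dvd_sum fun j _ => hα.trans (sub_one_dvd_pow_sub_one α j)
    have h2 := hB p hp _ hx γ hγ0 hγ (a * (α - 1) * k) (by convert h1 using 1; ring)
    convert h2 using 1
    push_cast
    ring

variable [IsDomain R]

theorem isSmoothOver_prod {S : Set R} (hS : ∀ σ ∈ S, Prime σ) (T : Finset R)
    (hT : ∀ σ ∈ T, σ ∈ S) : IsSmoothOver S (∏ σ ∈ T, σ) := by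
  intro π hπ h
  obtain ⟨σ, hσ, hd⟩ := (hπ.dvd_finsetProd_iff _).1 h
  exact ⟨σ, hT σ hσ, hπ.associated_of_dvd (hS σ (hT σ hσ)) hd⟩

variable [IsPrincipalIdealRing R]

theorem IsSmoothOver.isCoprime {S : Set R} {γ u : R} (hγ0 : γ ≠ 0) (hγ : IsSmoothOver S γ)
    (hu : ∀ σ ∈ S, ¬ σ ∣ u) : IsCoprime γ u := by
  refine isCoprime_of_prime_dvd (fun h => hγ0 h.1) fun π hπ hπγ hπu => ?_
  obtain ⟨σ, hσ, ha⟩ := hγ π hπ hπγ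
  exact hu σ hσ (ha.symm.dvd.trans hπu)

/-- Every nonzero element splits into a smooth part and a part prime to `S`. -/
theorem exists_smooth_mul {S : Set R} (hS : ∀ σ ∈ S, Prime σ) (x : R) (hx : x ≠ 0) :
    ∃ s u, x = s * u ∧ IsSmoothOver S s ∧ ∀ σ ∈ S, ¬ σ ∣ u := by
  revert hx
  refine UniqueFactorizationMonoid.induction_on_prime x (fun h => (h rfl).elim) ?_ ?_
  · intro x hx _
    exact ⟨1, x, (one_mul x).symm, .of_isUnit isUnit_one,
      fun σ hσ h => (hS σ hσ).not_isUnit (isUnit_of_dvd_unit h hx)⟩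
  · intro a p ha hp ih _
    obtain ⟨s, u, rfl, hs, hu⟩ := ih ha
    by_cases h : ∃ σ ∈ S, Associated p σ
    · refine ⟨p * s, u, (mul_assoc _ _ _).symm, IsSmoothOver.mul ?_ hs, hu⟩
      obtain ⟨σ, hσ, hpσ⟩ := h
      exact fun π hπ hd => ⟨σ, hσ, (hπ.associated_of_dvd hp hd).trans hpσ⟩
    · refine ⟨s, p * u, mul_left_comm _ _ _, hs, fun σ hσ hd => ?_⟩
      rcases (hS σ hσ).dvd_or_dvd hd with hd | hd
      · exact h ⟨σ, hσ, ((hS σ hσ).associated_of_dvd hp hd).symm⟩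
      · exact hu σ hσ hd

/-- There is a smooth modulus `B` that is so divisible that, for every rational prime `p`, the
smooth part of an element congruent to `p` modulo `B` divides `p`. The factor `a` makes the
statement usable inside products. -/
theorem exists_smooth_modulus [CharZero R] {S : Set R} (hfin : S.Finite)
    (hS : ∀ σ ∈ S, Prime σ) :
    ∃ B : R, B ≠ 0 ∧ IsSmoothOver S B ∧ ∀ p : ℕ, p.Prime → ∀ x : R, B ∣ x - p →
      ∀ γ : R, γ ≠ 0 → IsSmoothOver S γ → ∀ a, γ ∣ a * x → γ ∣ a * p := by
  have hA : (⋃ σ ∈ S, {p : ℕ | p.Prime ∧ σ ∣ (p : R)}).Finite :=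
    hfin.biUnion fun σ hσ => Set.Subsingleton.finite fun p hp q hq =>
      eq_of_prime_dvd_natCast (hS σ hσ) hp.1 hq.1 hp.2 hq.2
  -- `F` is divisible by every rational prime below `S`; its smooth part `s` absorbs the
  -- smooth part of each such prime.
  set F : ℕ := ∏ p ∈ hA.toFinset, p with hF
  have hF0 : (F : R) ≠ 0 := by
    rw [Nat.cast_ne_zero, hF, Finset.prod_ne_zero_iff]
    intro p hp
    simp only [Set.Finite.mem_toFinset, Set.mem_iUnion] at hp
    obtain ⟨σ, _, hp, _⟩ := hp
    exact hp.ne_zero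
  obtain ⟨s, u, hsu, hs, hu⟩ := exists_smooth_mul hS (F : R) hF0
  set r : R := ∏ σ ∈ hfin.toFinset, σ with hr
  have hdr : ∀ σ ∈ S, σ ∣ r := fun σ hσ =>
    Finset.dvd_prod_of_mem (fun σ => σ) (hfin.mem_toFinset.2 hσ)
  have hr0 : r ≠ 0 := Finset.prod_ne_zero_iff.2
    fun σ hσ => (hS σ (hfin.mem_toFinset.1 hσ)).ne_zero
  have hs0 : s ≠ 0 := by rintro rfl; simp at hsu; exact hF0 (by simpa using hsu)
  refine ⟨s * r, mul_ne_zero hs0 hr0,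
    hs.mul (isSmoothOver_prod hS _ fun σ hσ => hfin.mem_toFinset.1 hσ), ?_⟩
  intro p hp x hx γ hγ0 hγ a ha
  by_cases h : ∃ σ ∈ S, σ ∣ (p : R)
  · obtain ⟨τ, hτ, hτp⟩ := h
    have hpF : (p : R) ∣ F := Nat.cast_dvd_cast <|
      Finset.dvd_prod_of_mem (fun p => p) (hA.mem_toFinset.2 <|
        Set.mem_biUnion hτ ⟨hp, hτp⟩)
    have hp0 : (p : R) ≠ 0 := Nat.cast_ne_zero.2 hp.ne_zero
    obtain ⟨t, v, htv, ht, hv⟩ := exists_smooth_mul hS (p : R) hp0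
    have ht0 : t ≠ 0 := by rintro rfl; exact hp0 (by simpa using htv)
    have hts : t ∣ s := (ht.isCoprime ht0 hu).dvd_of_dvd_mul_right
      (((Dvd.intro v htv.symm).trans hpF).trans (dvd_of_eq hsu))
    obtain ⟨c, hc⟩ := (mul_dvd_mul_right hts r).trans hx
    have hx' : x = t * (v + r * c) := by linear_combination hc + htv
    have hco : IsCoprime γ (v + r * c) := hγ.isCoprime hγ0 fun σ hσ hd =>
      hv σ hσ ((dvd_add_left ((hdr σ hσ).mul_right c)).1 hd)
    rw [hx', ← mul_assoc] at ha
    rw [htv, ← mul_assoc]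
    exact (hco.dvd_of_dvd_mul_right ha).mul_right v
  · push Not at h
    have hco : IsCoprime γ x := hγ.isCoprime hγ0 fun σ hσ hd =>
      h σ hσ ((dvd_sub_right hd).1 (((hdr σ hσ).mul_left s).trans hx))
    exact (hco.dvd_of_dvd_mul_right ha).mul_right _

end Smooth

/-! ### Norms and multiplicative orders of Gaussian integers -/

theorem GaussianInt.finite_norm_le (M : ℝ) : {γ : GaussianInt | ‖(γ : ℂ)‖ ≤ M}.Finite := by
  have hf : ((Set.Icc (-⌈M⌉) ⌈M⌉ : Set ℤ) ×ˢ (Set.Icc (-⌈M⌉) ⌈M⌉ : Set ℤ)).Finite :=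
    (Set.finite_Icc _ _).prod (Set.finite_Icc _ _)
  refine Set.Finite.of_injOn (f := fun γ : GaussianInt => (γ.re, γ.im)) ?_ ?_ hf
  · intro γ hγ
    have h1 := (Complex.abs_re_le_norm (γ : ℂ)).trans (hγ.trans (Int.le_ceil M))
    have h2 := (Complex.abs_im_le_norm (γ : ℂ)).trans (hγ.trans (Int.le_ceil M))
    rw [← GaussianInt.intCast_re] at h1
    rw [← GaussianInt.intCast_im] at h2
    exact ⟨abs_le.1 (by exact_mod_cast h1), abs_le.1 (by exact_mod_cast h2)⟩
  · intro γ _ δ _ h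
    simp only [Prod.mk.injEq] at h
    exact Zsqrtd.ext h.1 h.2

theorem GaussianInt.one_le_norm {γ : GaussianInt} (h : γ ≠ 0) : 1 ≤ ‖(γ : ℂ)‖ := by
  have h1 : (1 : ℝ) ≤ ‖(γ : ℂ)‖ ^ 2 := by
    rw [← Complex.normSq_eq_norm_sq, ← GaussianInt.intCast_real_norm]
    exact_mod_cast GaussianInt.norm_pos.2 h
  nlinarith [_root_.norm_nonneg (γ : ℂ)]

theorem GaussianInt.norm_le_of_dvd {γ δ : GaussianInt} (h : γ ∣ δ) (hδ : δ ≠ 0) :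
    ‖(γ : ℂ)‖ ≤ ‖(δ : ℂ)‖ := by
  obtain ⟨ε, rfl⟩ := h
  rw [GaussianInt.toComplex_mul, norm_mul]
  exact le_mul_of_one_le_right (_root_.norm_nonneg _) (one_le_norm (right_ne_zero_of_mul hδ))

theorem GaussianInt.exists_dvd_pow_sub_one {β B : GaussianInt} (hB : B ≠ 0)
    (hco : IsCoprime B β) : ∃ m : ℕ, 0 < m ∧ B ∣ β ^ m - 1 := by
  have hfin : (Set.range fun n : ℕ => β ^ n % B).Finite := by
    refine (GaussianInt.finite_norm_le ‖(B : ℂ)‖).subset ?_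
    rintro _ ⟨n, rfl⟩
    have h := GaussianInt.norm_mod_lt (β ^ n) hB
    have h' : ‖((β ^ n % B : GaussianInt) : ℂ)‖ ^ 2 ≤ ‖(B : ℂ)‖ ^ 2 := by
      rw [← Complex.normSq_eq_norm_sq, ← Complex.normSq_eq_norm_sq,
        ← GaussianInt.intCast_real_norm, ← GaussianInt.intCast_real_norm]
      exact_mod_cast h.le
    exact le_of_sq_le_sq h' (_root_.norm_nonneg _)
  obtain ⟨n, -, m, -, hne, heq⟩ := Set.infinite_univ.exists_ne_map_eq_of_mapsTo
    (f := fun n : ℕ => β ^ n % B) (fun n _ => Set.mem_range_self n) hfin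
  wlog hlt : n < m generalizing n m
  · exact this m n hne.symm heq.symm (lt_of_le_of_ne (not_lt.1 hlt) hne.symm)
  refine ⟨m - n, Nat.sub_pos_of_lt hlt, ?_⟩
  have hd : B ∣ β ^ n * (β ^ (m - n) - 1) := by
    have : β ^ n * (β ^ (m - n) - 1) = β ^ m - β ^ n := by
      rw [mul_sub, ← pow_add, Nat.add_sub_cancel' hlt.le, mul_one]
    rw [this]
    have h1 := EuclideanDomain.div_add_mod (β ^ m) B
    have h2 := EuclideanDomain.div_add_mod (β ^ n) B
    exact ⟨β ^ m / B - β ^ n / B, by linear_combination h2 - h1 - heq⟩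
  exact (hco.pow_right).dvd_of_dvd_mul_left hd

theorem GaussianInt.pow_ne_one {β : GaussianInt} (hβ : 1 < ‖(β : ℂ)‖) {k : ℕ} (hk : k ≠ 0) :
    β ^ k - 1 ≠ 0 := by
  intro h
  have h1 : ‖(β : ℂ)‖ ^ k = 1 := by
    rw [← _root_.norm_pow, ← map_pow, sub_eq_zero.1 h]; simp
  exact (one_lt_pow₀ hβ hk).ne' h1

/-- The multiplicative order of `β` modulo a smooth `γ` is at least a constant times `|γ|`. -/
theorem GaussianInt.exists_norm_le_mul_order {β q : GaussianInt} (hβ : 1 < ‖(β : ℂ)‖)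
    (hq : q ≠ 0) {S : Set GaussianInt} (hfin : S.Finite) (hS : ∀ σ ∈ S, Prime σ)
    (hSβ : ∀ σ ∈ S, ¬ σ ∣ β) :
    ∃ C : ℝ, 0 < C ∧ ∀ γ : GaussianInt, γ ≠ 0 → IsSmoothOver S γ → ∀ k : ℕ, 0 < k →
      γ ∣ q * (β ^ k - 1) → ‖(γ : ℂ)‖ ≤ C * k := by
  obtain ⟨B, hB0, hBs, hB⟩ := exists_smooth_modulus hfin hS
  obtain ⟨m, hm, hBm⟩ := exists_dvd_pow_sub_one hB0 (hBs.isCoprime hB0 hSβ)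
  have hne : q * (β ^ m - 1) ≠ 0 := mul_ne_zero hq (pow_ne_one hβ hm.ne')
  refine ⟨‖((q * (β ^ m - 1) : GaussianInt) : ℂ)‖,
    zero_lt_one.trans_le (one_le_norm hne), fun γ hγ0 hγ k hk h => ?_⟩
  have h1 : γ ∣ q * ((β ^ m) ^ k - 1) := by
    refine h.trans (mul_dvd_mul_left q ?_)
    rw [← pow_mul, mul_comm, pow_mul]
    exact sub_one_dvd_pow_sub_one _ _
  have h2 := dvd_mul_natCast_of_dvd_pow_sub_one hB hγ0 hγ k q (β ^ m) hBm h1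
  have h3 := norm_le_of_dvd h2 (mul_ne_zero hne (Nat.cast_ne_zero.2 hk.ne'))
  simpa using h3

/-! ### Covers of sets of small Hausdorff measure -/

/-- A compact set that is null for the `t`-dimensional Hausdorff measure has finite covers with
arbitrarily small `t`-sums. The numbers `r i` bound the diameters and are positive, even when a
covering set has at most one point. -/
theorem IsCompact.exists_finite_cover_sum_rpow_le {X : Type*} [MetricSpace X] [MeasurableSpace X]
    [BorelSpace X] {K : Set X} (hK : IsCompact K) {t : ℝ} (ht : 0 < t) (ht1 : t ≤ 1)
    (h0 : μH[t] K = 0) {ε : ℝ} (hε : 0 < ε) :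
    ∃ (F : Finset ℕ) (U : ℕ → Set X) (r : ℕ → ℝ), K ⊆ ⋃ i ∈ F, U i ∧ (∀ i, 0 < r i) ∧
      (∀ i, ∀ x ∈ U i, ∀ y ∈ U i, dist x y ≤ r i) ∧ ∑ i ∈ F, r i ^ t ≤ ε := by
  have hε' : (0 : ℝ≥0∞) < ENNReal.ofReal (ε / 2) := by simpa using hε
  have h1 : (⨅ (T : ℕ → Set X) (_ : K ⊆ ⋃ n, T n) (_ : ∀ n, Metric.ediam (T n) ≤ 1),
      ∑' n, ⨆ _ : (T n).Nonempty, Metric.ediam (T n) ^ t) < ENNReal.ofReal (ε / 2) := by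
    refine lt_of_le_of_lt ?_ hε'
    rw [← h0, Measure.hausdorffMeasure_apply]
    exact le_iSup₂_of_le 1 one_pos le_rfl
  simp only [iInf_lt_iff] at h1
  obtain ⟨T, hKT, hT1, hsum⟩ := h1
  obtain ⟨η, hη, hηsum⟩ := ENNReal.exists_pos_sum_of_countable hε'.ne' ℕ
  -- Thickening by `δ i` increases the `t`-sum by at most `∑ i, η i`.
  set δ : ℕ → ℝ≥0 := fun i => (η i) ^ (1 / t) / 2 with hδ
  have hδ0 : ∀ i, 0 < δ i := fun i => by have := hη i; positivity
  have hfinT : ∀ i, Metric.ediam (T i) ≠ ⊤ := fun i =>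
    ne_top_of_le_ne_top ENNReal.one_ne_top (hT1 i)
  set r : ℕ → ℝ≥0 := fun i => (Metric.ediam (T i)).toNNReal + 2 * δ i with hr
  have hrE : ∀ i, (r i : ℝ≥0∞) = Metric.ediam (T i) + 2 * δ i := fun i => by
    simp [hr, ENNReal.coe_toNNReal (hfinT i)]
  obtain ⟨F, hF⟩ := hK.elim_finite_subcover (fun i => Metric.thickening (δ i) (T i))
    (fun i => Metric.isOpen_thickening)
    (hKT.trans (Set.iUnion_mono fun i => Metric.self_subset_thickening (by exact_mod_cast hδ0 i) _))
  refine ⟨F, fun i => Metric.thickening (δ i) (T i), fun i => r i, hF,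
    fun i => ?_, fun i x hx y hy => ?_, ?_⟩
  · have := hδ0 i
    simp only [hr, NNReal.coe_pos]
    positivity
  · have h := (Metric.edist_le_ediam_of_mem hx hy).trans
      (Metric.ediam_thickening_le (s := T i) (δ i))
    rw [← hrE, edist_nndist, ENNReal.coe_le_coe] at h
    exact_mod_cast h
  · have hterm : ∀ i, ((r i ^ t : ℝ≥0) : ℝ≥0∞) ≤
        (⨆ _ : (T i).Nonempty, Metric.ediam (T i) ^ t) + η i := fun i => by
      rw [ENNReal.coe_rpow_of_nonneg _ ht.le, hrE]
      refine (ENNReal.rpow_add_le_add_rpow _ _ ht.le ht1).trans (add_le_add ?_ ?_)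
      · rcases (T i).eq_empty_or_nonempty with h | h
        · simp [h, ht]
        · simp [h]
      · have : (2 * δ i : ℝ≥0) ^ t = η i := by
          rw [hδ, mul_div_cancel₀ _ two_ne_zero, ← NNReal.rpow_mul, one_div,
            inv_mul_cancel₀ ht.ne', NNReal.rpow_one]
        rw [← this, ENNReal.coe_rpow_of_nonneg _ ht.le]
        simp
    have hle : ((∑ i ∈ F, r i ^ t : ℝ≥0) : ℝ≥0∞) ≤ ENNReal.ofReal ε := by
      rw [ENNReal.ofNNReal_finsetSum]
      calc _ ≤ ∑ i ∈ F, ((⨆ _ : (T i).Nonempty, Metric.ediam (T i) ^ t) + η i) :=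
            Finset.sum_le_sum fun i _ => hterm i
        _ ≤ ∑' i, ((⨆ _ : (T i).Nonempty, Metric.ediam (T i) ^ t) + η i) :=
            ENNReal.sum_le_tsum _
        _ = _ := ENNReal.tsum_add
        _ ≤ ENNReal.ofReal (ε / 2) + ENNReal.ofReal (ε / 2) := add_le_add hsum.le hηsum.le
        _ = ENNReal.ofReal ε := by
            rw [← ENNReal.ofReal_add (by positivity) (by positivity), add_halves]
    rw [ENNReal.ofReal, ENNReal.coe_le_coe] at hle
    have := NNReal.coe_le_coe.2 hle
    rw [Real.coe_toNNReal _ hε.le] at this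
    simpa using this

/-! ### Counting separated points of an invariant set -/

/-- The points of `P` are `ρ`-separated in the quotient `ℂ / Λ`. -/
def SeparatedMod (Λ : AddSubgroup ℂ) (ρ : ℝ) (P : Finset ℂ) : Prop :=
  ∀ x ∈ P, ∀ y ∈ P, x ≠ y → ∀ l ∈ Λ, ρ ≤ ‖x - y - l‖

theorem SeparatedMod.mono {Λ : AddSubgroup ℂ} {ρ ρ' : ℝ} {P Q : Finset ℂ}
    (h : SeparatedMod Λ ρ P) (hρ : ρ' ≤ ρ) (hQ : Q ⊆ P) : SeparatedMod Λ ρ' Q :=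
  fun x hx y hy hne l hl => hρ.trans (h x (hQ hx) y (hQ hy) hne l hl)

theorem TotallyBounded.exists_card_le_of_separatedMod {K : Set ℂ} (hK : TotallyBounded K)
    (Λ : AddSubgroup ℂ) {ρ : ℝ} (hρ : 0 < ρ) :
    ∃ N : ℕ, ∀ P : Finset ℂ, (P : Set ℂ) ⊆ K → SeparatedMod Λ ρ P → P.card ≤ N := by
  obtain ⟨Y, hY, hcov⟩ := Metric.totallyBounded_iff.1 hK (ρ / 2) (half_pos hρ)
  refine ⟨hY.toFinset.card, fun P hP hsep => ?_⟩
  have : ∀ x ∈ P, ∃ y ∈ hY.toFinset, dist x y < ρ / 2 := fun x hx => by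
    simpa using hcov (hP hx)
  choose! f hf hd using this
  refine Finset.card_le_card_of_injOn f hf fun x hx y hy hxy => ?_
  by_contra hne
  have h1 := hsep x hx y hy hne 0 Λ.zero_mem
  rw [sub_zero, ← dist_eq_norm] at h1
  have h2 := dist_triangle_right x y (f x)
  have h3 := hd x hx
  have h4 := hd y hy
  rw [← hxy] at h4
  linarith

/-- Expansion by `b` keeps a set of small diameter separated modulo `Λ`: the nonzero elements of
`Λ` are at distance at least `c` from the origin, so wrapping around cannot bring points close. -/
theorem SeparatedMod.exists_image {Λ : AddSubgroup ℂ} {c : ℝ}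
    (hΛ : ∀ l ∈ Λ, l ≠ 0 → c ≤ ‖l‖) {b : ℂ} {K : Set ℂ}
    (hK : ∀ x ∈ K, ∃ y ∈ K, b * x - y ∈ Λ) {ρ r : ℝ} (hb : 0 < ‖b‖) (hρ : 0 < ρ)
    (hr : ‖b‖ * r ≤ c / 2)
    {P : Finset ℂ} (hP : (P : Set ℂ) ⊆ K) (hsep : SeparatedMod Λ ρ P)
    (hdiam : ∀ x ∈ P, ∀ y ∈ P, dist x y ≤ r) :
    ∃ Q : Finset ℂ, (Q : Set ℂ) ⊆ K ∧ SeparatedMod Λ (‖b‖ * ρ) Q ∧ Q.card = P.card := by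
  have : ∀ x ∈ P, ∃ y ∈ K, b * x - y ∈ Λ := fun x hx => hK x (hP hx)
  choose! f hfK hfΛ using this
  have key : ∀ x ∈ P, ∀ y ∈ P, x ≠ y → ∀ l ∈ Λ, ‖b‖ * ρ ≤ ‖f x - f y - l‖ := by
    intro x hx y hy hne l hl
    set l' := (b * x - f x) - (b * y - f y) + l with hl'
    have hmem : l' ∈ Λ := Λ.add_mem (Λ.sub_mem (hfΛ x hx) (hfΛ y hy)) hl
    have heq : f x - f y - l = b * (x - y) - l' := by rw [hl']; ring
    have h1 : ρ ≤ ‖x - y‖ := by simpa using hsep x hx y hy hne 0 Λ.zero_mem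
    have h2 : ‖x - y‖ ≤ r := by simpa [dist_eq_norm] using hdiam x hx y hy
    have h3 : ‖b‖ * ρ ≤ ‖b‖ * ‖x - y‖ := by gcongr
    have h4 : ‖b‖ * ‖x - y‖ ≤ ‖b‖ * r := by gcongr
    rw [heq]
    by_cases h0 : l' = 0
    · rwa [h0, sub_zero, norm_mul]
    · have h5 := hΛ l' hmem h0
      have h6 := norm_sub_norm_le l' (b * (x - y))
      rw [norm_sub_rev, norm_mul] at h6
      linarith
  have hpos : 0 < ‖b‖ * ρ := mul_pos hb hρ
  have hinj : Set.InjOn f P := fun x hx y hy hxy => by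
    by_contra hne
    have := key x hx y hy hne 0 Λ.zero_mem
    rw [hxy, sub_self, sub_zero, norm_zero] at this
    linarith
  refine ⟨P.image f, ?_, ?_, Finset.card_image_of_injOn hinj⟩
  · intro y hy
    obtain ⟨x, hx, rfl⟩ := Finset.mem_image.1 (Finset.mem_coe.1 hy)
    exact hfK x hx
  · intro x' hx' y' hy' hne
    obtain ⟨x, hx, rfl⟩ := Finset.mem_image.1 hx'
    obtain ⟨y, hy, rfl⟩ := Finset.mem_image.1 hy'
    exact key x hx y hy fun h => hne (h ▸ rfl)

theorem exists_pow_sub_mem {Λ : AddSubgroup ℂ} {b : ℂ} (hbΛ : ∀ l ∈ Λ, b * l ∈ Λ) {K : Set ℂ}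
    (hK : ∀ x ∈ K, ∃ y ∈ K, b * x - y ∈ Λ) (n : ℕ) :
    ∀ x ∈ K, ∃ y ∈ K, b ^ n * x - y ∈ Λ := by
  induction n with
  | zero => exact fun x hx => ⟨x, hx, by simp⟩
  | succ n ih =>
    intro x hx
    obtain ⟨y, hy, hxy⟩ := ih x hx
    obtain ⟨z, hz, hyz⟩ := hK y hy
    refine ⟨z, hz, ?_⟩
    have : b ^ (n + 1) * x - z = b * (b ^ n * x - y) + (b * y - z) := by ring
    rw [this]
    exact Λ.add_mem (hbΛ _ hxy) hyz

theorem Finset.exists_pos_le {ι : Type*} (F : Finset ι) {r : ι → ℝ} (hr : ∀ i, 0 < r i) :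
    ∃ δ, 0 < δ ∧ ∀ i ∈ F, δ ≤ r i := by
  classical
  induction F using Finset.induction_on with
  | empty => exact ⟨1, one_pos, by simp⟩
  | insert a F _ ih =>
    obtain ⟨δ, hδ, h⟩ := ih
    refine ⟨min δ (r a), lt_min hδ (hr a), fun i hi => ?_⟩
    rcases Finset.mem_insert.1 hi with rfl | hi
    · exact min_le_right _ _
    · exact (min_le_left _ _).trans (h i hi)

/-- A compact set that is invariant under the expansion `z ↦ b z` modulo a discrete group, and
null for the `t`-dimensional Hausdorff measure, has upper box dimension at most `t`. The pieces
of a cover with small `t`-sum are expanded to a fixed size, which bounds the number of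
`ρ`-separated points by the numbers for larger `ρ`. -/
theorem IsCompact.exists_card_le_rpow_of_invariant {Λ : AddSubgroup ℂ} {c : ℝ} (hc : 0 < c)
    (hΛ : ∀ l ∈ Λ, l ≠ 0 → c ≤ ‖l‖) {b : ℂ} (hb : 1 < ‖b‖) (hbΛ : ∀ l ∈ Λ, b * l ∈ Λ)
    {K : Set ℂ} (hKc : IsCompact K) (hK : ∀ x ∈ K, ∃ y ∈ K, b * x - y ∈ Λ)
    {t : ℝ} (ht : 0 < t) (ht1 : t ≤ 1) (h0 : μH[t] K = 0) :
    ∃ C : ℝ, 0 < C ∧ ∀ ρ : ℝ, 0 < ρ → ρ ≤ c / 2 → ∀ P : Finset ℂ, (P : Set ℂ) ⊆ K →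
      SeparatedMod Λ ρ P → (P.card : ℝ) ≤ C * ρ ^ (-t) := by
  have hb0 : 0 < ‖b‖ := one_pos.trans hb
  -- `c / (2 ‖b‖)` is the least size to which pieces are expanded below.
  set w : ℝ := c / (2 * ‖b‖) with hw
  have hw0 : 0 < w := by positivity
  obtain ⟨F, U, r, hcov, hr0, hdiam, hsum⟩ :=
    hKc.exists_finite_cover_sum_rpow_le ht ht1 h0 (Real.rpow_pos_of_pos hw0 t)
  have hrw : ∀ i ∈ F, r i ≤ w := fun i hi => by
    have h1 : r i ^ t ≤ w ^ t := (Finset.single_le_sum (f := fun i => r i ^ t)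
      (fun j _ => Real.rpow_nonneg (hr0 j).le t) hi).trans hsum
    exact (Real.rpow_le_rpow_iff (hr0 i).le hw0.le ht).1 h1
  have hn : ∀ i ∈ F, ∃ n : ℕ, 0 < n ∧ ‖b‖ ^ n * r i ≤ c / 2 ∧ w ≤ ‖b‖ ^ n * r i := by
    intro i hi
    have hri := hr0 i
    have hle : ‖b‖ * r i ≤ c / 2 := by
      calc ‖b‖ * r i ≤ ‖b‖ * w := by gcongr; exact hrw i hi
        _ = c / 2 := by rw [hw]; field_simp
    have h1 : 1 ≤ c / (2 * r i) := by
      rw [le_div_iff₀ (by positivity)]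
      nlinarith
    obtain ⟨n, hn1, hn2⟩ := exists_nat_pow_near h1 hb
    rw [le_div_iff₀ (by positivity)] at hn1
    rw [div_lt_iff₀ (by positivity)] at hn2
    refine ⟨n, ?_, by linarith, ?_⟩
    · rcases Nat.eq_zero_or_pos n with rfl | h
      · simp only [zero_add, pow_one] at hn2
        linarith
      · exact h
    · rw [hw, div_le_iff₀ (by positivity)]
      calc c ≤ ‖b‖ ^ (n + 1) * (2 * r i) := hn2.le
        _ = _ := by ring
  choose! n hnpos hnle hnge using hn
  obtain ⟨δ, hδ, hδr⟩ := F.exists_pos_le hr0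
  obtain ⟨N, hN⟩ := hKc.totallyBounded.exists_card_le_of_separatedMod Λ hδ
  set C : ℝ := (N + 1) * (c / 2) ^ t with hC
  have hC0 : 0 < C := by positivity
  refine ⟨C, hC0, ?_⟩
  have hind : ∀ j : ℕ, ∀ ρ : ℝ, 0 < ρ → ρ ≤ c / 2 → δ < ‖b‖ ^ j * ρ → ∀ P : Finset ℂ,
      (P : Set ℂ) ⊆ K → SeparatedMod Λ ρ P → (P.card : ℝ) ≤ C * ρ ^ (-t) := by
    intro j
    induction j with
    | zero =>
      intro ρ hρ hρc hj P hP hsep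
      rw [pow_zero, one_mul] at hj
      have h1 : (P.card : ℝ) ≤ N := by
        exact_mod_cast hN P hP (hsep.mono hj.le subset_rfl)
      have h2 : 1 ≤ (c / 2) ^ t * ρ ^ (-t) := by
        rw [Real.rpow_neg hρ.le, ← div_eq_mul_inv, one_le_div (by positivity)]
        exact Real.rpow_le_rpow hρ.le hρc ht.le
      rw [hC, mul_assoc]
      nlinarith [(Nat.cast_nonneg N : (0 : ℝ) ≤ N)]
    | succ j ih =>
      intro ρ hρ hρc hj P hP hsep
      by_cases hρδ : δ < ρ
      · refine ih ρ hρ hρc (hρδ.trans_le ?_) P hP hsep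
        exact le_mul_of_one_le_left hρ.le (one_le_pow₀ hb.le)
      classical
      have hpiece : ∀ i ∈ F, ((P.filter (· ∈ U i)).card : ℝ) ≤
          C * ρ ^ (-t) * (r i ^ t / w ^ t) := by
        intro i hi
        have hsub : P.filter (· ∈ U i) ⊆ P := Finset.filter_subset _ _
        obtain ⟨Q, hQK, hQsep, hQcard⟩ := SeparatedMod.exists_image hΛ
          (exists_pow_sub_mem hbΛ hK (n i)) (ρ := ρ) (r := r i)
          (by rw [norm_pow]; positivity) hρ (by rw [norm_pow]; exact hnle i hi)
          (P := P.filter (· ∈ U i)) (fun x hx => hP (hsub hx)) (hsep.mono le_rfl hsub)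
          (fun x hx y hy => hdiam i x (Finset.mem_filter.1 hx).2 y (Finset.mem_filter.1 hy).2)
        rw [norm_pow] at hQsep
        have hbn : ‖b‖ ≤ ‖b‖ ^ n i := le_self_pow₀ hb.le (hnpos i hi).ne'
        have h1 := ih (‖b‖ ^ n i * ρ) (by positivity)
          (le_trans (by gcongr; exact (not_lt.1 hρδ).trans (hδr i hi)) (hnle i hi))
          (hj.trans_le (by rw [pow_succ, mul_assoc]; gcongr)) Q hQK hQsep
        rw [hQcard] at h1
        refine h1.trans ?_
        rw [Real.mul_rpow (by positivity) hρ.le, mul_assoc C, mul_comm (_ ^ (-t)) (ρ ^ (-t))]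
        refine mul_le_mul_of_nonneg_left (mul_le_mul_of_nonneg_left ?_ (by positivity)) hC0.le
        rw [Real.rpow_neg (by positivity), ← Real.div_rpow (hr0 i).le hw0.le,
          ← Real.inv_rpow (by positivity)]
        refine Real.rpow_le_rpow (by positivity) ?_ ht.le
        rw [inv_le_iff_one_le_mul₀ (by positivity), div_mul_eq_mul_div, one_le_div hw0, mul_comm]
        exact hnge i hi
      have hPcov : P ⊆ F.biUnion fun i => P.filter (· ∈ U i) := fun x hx => by
        obtain ⟨i, hi, hxi⟩ := Set.mem_iUnion₂.1 (hcov (hP hx))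
        exact Finset.mem_biUnion.2 ⟨i, hi, Finset.mem_filter.2 ⟨hx, hxi⟩⟩
      have hcard : (P.card : ℝ) ≤ ∑ i ∈ F, ((P.filter (· ∈ U i)).card : ℝ) := by
        exact_mod_cast (Finset.card_le_card hPcov).trans Finset.card_biUnion_le
      calc (P.card : ℝ) ≤ ∑ i ∈ F, C * ρ ^ (-t) * (r i ^ t / w ^ t) :=
            hcard.trans (Finset.sum_le_sum hpiece)
        _ = C * ρ ^ (-t) * ((∑ i ∈ F, r i ^ t) / w ^ t) := by
            rw [Finset.sum_div, Finset.mul_sum]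
        _ ≤ C * ρ ^ (-t) * 1 := by
            gcongr
            exact div_le_one_of_le₀ hsum (by positivity)
        _ = C * ρ ^ (-t) := mul_one _
  intro ρ hρ hρc
  obtain ⟨j, hj⟩ := pow_unbounded_of_one_lt (δ / ρ) hb
  exact hind j ρ hρ hρc (by rwa [div_lt_iff₀ hρ] at hj)

/-! ### The self-similar set and its rational points -/

theorem exists_common_denominator {D : Set ℂ} (hfin : D.Finite) (hD : D ⊆ gaussianRationals) :
    ∃ q : GaussianInt, q ≠ 0 ∧ ∀ d ∈ D, ∃ a : GaussianInt, (q : ℂ) * d = a := by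
  induction D, hfin using Set.Finite.induction_on with
  | empty => exact ⟨1, one_ne_zero, by simp⟩
  | @insert z D _ _ ih =>
    obtain ⟨q, hq, h⟩ := ih ((Set.subset_insert _ _).trans hD)
    obtain ⟨ω, γ, hγ, rfl⟩ := hD (Set.mem_insert _ _)
    have hγ' : (γ : ℂ) ≠ 0 := by simpa using hγ
    refine ⟨q * γ, mul_ne_zero hq hγ, fun d hd => ?_⟩
    rcases hd with rfl | hd
    · exact ⟨q * ω, by rw [map_mul, map_mul, mul_assoc, mul_div_cancel₀ _ hγ']⟩
    · obtain ⟨a, ha⟩ := h d hd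
      exact ⟨a * γ, by rw [map_mul, map_mul, ← ha]; ring⟩

/-- The lattice `q⁻¹ ℤ[i]`, encoded (for `q ≠ 0`) as the set of all `l` with `q l ∈ ℤ[i]`. -/
def denomLattice (q : GaussianInt) : AddSubgroup ℂ :=
  GaussianInt.toComplex.toAddMonoidHom.range.comap (AddMonoidHom.mulLeft (q : ℂ))

theorem mem_denomLattice {q : GaussianInt} {l : ℂ} :
    l ∈ denomLattice q ↔ ∃ a : GaussianInt, (a : ℂ) = q * l := Iff.rfl

theorem mul_mem_denomLattice {q : GaussianInt} (β : GaussianInt) {l : ℂ}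
    (h : l ∈ denomLattice q) : (β : ℂ) * l ∈ denomLattice q := by
  obtain ⟨a, ha⟩ := mem_denomLattice.1 h
  exact mem_denomLattice.2 ⟨β * a, by rw [map_mul, ha]; ring⟩

theorem inv_norm_le_of_mem_denomLattice {q : GaussianInt} (hq : q ≠ 0) {l : ℂ}
    (h : l ∈ denomLattice q) (hl : l ≠ 0) : ‖(q : ℂ)‖⁻¹ ≤ ‖l‖ := by
  obtain ⟨a, ha⟩ := mem_denomLattice.1 h
  have hq' : (q : ℂ) ≠ 0 := by simpa using hq
  have ha0 : a ≠ 0 := by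
    rintro rfl
    rw [map_zero] at ha
    exact mul_ne_zero hq' hl ha.symm
  have h1 := GaussianInt.one_le_norm ha0
  rw [ha, norm_mul] at h1
  exact (inv_le_iff_one_le_mul₀' (norm_pos_iff.2 hq')).2 h1

theorem isCompact_selfSimilarSet {β : GaussianInt} (hβ : 1 < ‖(β : ℂ)‖) {D : Set ℂ}
    (hD : D.Finite) : IsCompact (selfSimilarSet β D) := by
  obtain ⟨M, hM⟩ := hD.isBounded.exists_norm_le
  have hbound : ∀ (d : ℕ → D) (j : ℕ),
      ‖(d j : ℂ) / (β : ℂ) ^ (j + 1)‖ ≤ M * ‖(β : ℂ)‖⁻¹ ^ (j + 1) := fun d j => by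
    rw [norm_div, norm_pow, div_eq_mul_inv, inv_pow]
    gcongr
    exact hM _ (d j).2
  have hsum : Summable fun j : ℕ => M * ‖(β : ℂ)‖⁻¹ ^ (j + 1) :=
    ((summable_nat_add_iff 1).2 (summable_geometric_of_lt_one (by positivity)
      (inv_lt_one_of_one_lt₀ hβ))).mul_left M
  have heq : selfSimilarSet β D =
      Set.range fun d : ℕ → D => ∑' j, (d j : ℂ) / (β : ℂ) ^ (j + 1) := by
    ext z
    constructor
    · rintro ⟨d, hd, hz⟩
      exact ⟨fun j => ⟨d j, hd j⟩, hz.tsum_eq⟩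
    · rintro ⟨d, rfl⟩
      exact ⟨fun j => d j, fun j => (d j).2,
        (Summable.of_norm_bounded hsum (hbound d)).hasSum⟩
  have := hD.to_subtype
  rw [heq]
  refine isCompact_range (continuous_tsum (fun j => ?_) hsum fun j d => hbound d j)
  exact (continuous_subtype_val.comp (continuous_apply j)).div_const _

/-- Multiplication by `β` shifts the digit sequence, up to the leading digit. -/
theorem exists_mul_sub_mem_denomLattice {β : GaussianInt} (hβ : β ≠ 0) {D : Set ℂ}
    {q : GaussianInt} (hq : ∀ d ∈ D, ∃ a : GaussianInt, (q : ℂ) * d = a) {x : ℂ}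
    (hx : x ∈ selfSimilarSet β D) :
    ∃ y ∈ selfSimilarSet β D, (β : ℂ) * x - y ∈ denomLattice q := by
  obtain ⟨d, hd, hsum⟩ := hx
  have hβ' : (β : ℂ) ≠ 0 := by simpa using hβ
  have h1 := ((hasSum_nat_add_iff' 1).2 hsum).mul_left (β : ℂ)
  refine ⟨(β : ℂ) * (x - ∑ j ∈ Finset.range 1, d j / (β : ℂ) ^ (j + 1)),
    ⟨fun j => d (j + 1), fun j => hd _, ?_⟩, ?_⟩
  · refine (funext fun j => ?_ : (fun j => d (j + 1) / (β : ℂ) ^ (j + 1)) = _) ▸ h1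
    rw [pow_succ _ (j + 1)]
    field_simp
  · obtain ⟨a, ha⟩ := hq (d 0) (hd 0)
    refine mem_denomLattice.2 ⟨a, ?_⟩
    rw [← ha, Finset.sum_range_one, zero_add, pow_one, mul_sub (β : ℂ),
      mul_div_cancel₀ _ hβ', sub_sub_cancel]

theorem exists_coprime_of_mem_gaussianRationalsWithDenomIn {S : Set GaussianInt} {z : ℂ}
    (hz : z ∈ gaussianRationalsWithDenomIn S) :
    ∃ ω γ : GaussianInt, γ ≠ 0 ∧ IsSmoothOver S γ ∧ IsCoprime γ ω ∧ z = (ω : ℂ) / (γ : ℂ) := by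
  classical
  obtain ⟨ω, γ, hγ, hS, rfl⟩ := hz
  let _ := EuclideanDomain.gcdMonoid GaussianInt
  obtain ⟨ω', γ', h1, h2, hu⟩ := extract_gcd ω γ
  set g := gcd ω γ
  have hg : g ≠ 0 := fun h => hγ (by rw [h2, h, zero_mul])
  have hγ' : γ' ≠ 0 := fun h => hγ (by rw [h2, h, mul_zero])
  refine ⟨ω', γ', hγ', IsSmoothOver.of_dvd hS (Dvd.intro_left g h2.symm),
    (gcd_isUnit_iff ω' γ').1 hu |>.symm, ?_⟩
  rw [h1, h2, map_mul, map_mul, mul_div_mul_left]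
  simpa using hg

/-- Distinct points of the orbit of `ω / γ` under multiplication by `β`, taken modulo
`q⁻¹ ℤ[i]`, are separated because all of them have denominator `q γ`. Here `y` lists
representatives of the orbit. -/
theorem GaussianInt.le_norm_sub_sub_of_orbit {β q ω γ : GaussianInt} (hq : q ≠ 0) (hγ : γ ≠ 0)
    (hω : IsCoprime γ ω) (hβ : IsCoprime γ β) {y : ℕ → ℂ}
    (hy : ∀ n, (β : ℂ) ^ n * ((ω : ℂ) / (γ : ℂ)) - y n ∈ denomLattice q) {m n : ℕ} (hmn : m < n)
    (hord : ¬ γ ∣ q * (β ^ (n - m) - 1)) {l : ℂ} (hl : l ∈ denomLattice q) :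
    (‖(q : ℂ)‖ * ‖(γ : ℂ)‖)⁻¹ ≤ ‖y n - y m - l‖ := by
  have hq' : (q : ℂ) ≠ 0 := by simpa using hq
  have hγ' : (γ : ℂ) ≠ 0 := by simpa using hγ
  obtain ⟨a, ha⟩ := mem_denomLattice.1 (add_mem (sub_mem (hy n) (hy m)) hl)
  set e : GaussianInt := q * (β ^ n - β ^ m) * ω - γ * a with he
  have hez : (e : ℂ) = (q * γ) * (y n - y m - l) := by
    rw [he]
    simp only [map_sub, map_mul, map_pow, ha]
    field_simp
    ring
  have he0 : e ≠ 0 := by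
    intro h0
    refine hord ((hβ.pow_right (n := m)).dvd_of_dvd_mul_right (hω.dvd_of_dvd_mul_right ⟨a, ?_⟩))
    rw [← sub_eq_zero, ← h0, he, ← Nat.add_sub_cancel' hmn.le, pow_add, Nat.add_sub_cancel_left]
    ring
  have h1 := one_le_norm he0
  rw [hez, norm_mul, norm_mul] at h1
  exact (inv_le_iff_one_le_mul₀' (by positivity)).2 h1

theorem theorem1p1 (β : GaussianInt) (hβ : 1 < ‖(β : ℂ)‖)
    (D : Set ℂ) (hDfin : D.Finite) (hD : D ⊆ gaussianRationals)
    (S : Set GaussianInt) (hSfin : S.Finite)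
    (hSprime : ∀ σ ∈ S, Prime σ)
    (hSnonassoc : S.Pairwise fun σ τ => ¬ Associated σ τ)
    (hSβ : ∀ σ ∈ S, ¬ σ ∣ β)
    (hdim : dimH (selfSimilarSet β D) < 1) :
    (selfSimilarSet β D ∩ gaussianRationalsWithDenomIn S).Finite := by
  have hβ0 : β ≠ 0 := by rintro rfl; norm_num at hβ
  obtain ⟨t, hdt, ht1⟩ := ENNReal.lt_iff_exists_nnreal_btwn.1 hdim
  have ht0 : (0 : ℝ) < t := by exact_mod_cast zero_le.trans_lt hdt
  replace ht1 : (t : ℝ) < 1 := by exact_mod_cast ht1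
  have hKc := isCompact_selfSimilarSet hβ hDfin
  obtain ⟨q, hq, hqD⟩ := exists_common_denominator hDfin hD
  have hq0 : 0 < ‖(q : ℂ)‖ := one_pos.trans_le (GaussianInt.one_le_norm hq)
  have hinv := fun x => exists_mul_sub_mem_denomLattice (x := x) hβ0 hqD
  obtain ⟨A, hA, hcount⟩ := hKc.exists_card_le_rpow_of_invariant (inv_pos.2 hq0)
    (fun l hl => inv_norm_le_of_mem_denomLattice hq hl) hβ
    (fun l hl => mul_mem_denomLattice β hl) hinv ht0 ht1.le (hausdorffMeasure_of_dimH_lt hdt)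
  obtain ⟨C, hC, hord⟩ := GaussianInt.exists_norm_le_mul_order hβ hq hSfin hSprime hSβ
  set M : ℝ := (C * (A * (2 * ‖(q : ℂ)‖) ^ (t : ℝ))) ^ (1 - (t : ℝ))⁻¹ with hM
  have hden : ∀ ω γ : GaussianInt, γ ≠ 0 → IsSmoothOver S γ → IsCoprime γ ω →
      (ω : ℂ) / (γ : ℂ) ∈ selfSimilarSet β D → ‖(γ : ℂ)‖ ≤ M := by
    intro ω γ hγ hγS hω hx
    have hγ1 := GaussianInt.one_le_norm hγ
    have hγ0 : 0 < ‖(γ : ℂ)‖ := one_pos.trans_le hγ1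
    choose y hyK hy using fun n =>
      exists_pow_sub_mem (fun l hl => mul_mem_denomLattice β hl) hinv n _ hx
    -- The first `N` points of the orbit are distinct modulo `q⁻¹ ℤ[i]`.
    set N : ℕ := ⌈‖(γ : ℂ)‖ / C⌉₊ with hN
    -- The factor `2` makes `ρ` at most half the length of the shortest lattice vectors.
    set ρ : ℝ := (2 * ‖(q : ℂ)‖ * ‖(γ : ℂ)‖)⁻¹ with hρ
    have hρ0 : 0 < ρ := by positivity
    have hlt : ∀ m n : ℕ, m < n → n < N → ∀ l ∈ denomLattice q, ρ ≤ ‖y n - y m - l‖ := by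
      intro m n hmn hnN l hl
      refine le_trans ?_ (GaussianInt.le_norm_sub_sub_of_orbit hq hγ hω
        (hγS.isCoprime hγ hSβ) hy hmn (fun h => ?_) hl)
      · rw [hρ]
        gcongr
        linarith
      · have h1 := hord γ hγ hγS (n - m) (Nat.sub_pos_of_lt hmn) h
        have h2 := (lt_div_iff₀ hC).1 (Nat.lt_ceil.1 ((Nat.sub_le n m).trans_lt hnN))
        linarith
    have hsep : ∀ m n : ℕ, m ≠ n → m < N → n < N → ∀ l ∈ denomLattice q,
        ρ ≤ ‖y n - y m - l‖ := by
      intro m n hne hm hn l hl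
      rcases hne.lt_or_gt with h | h
      · exact hlt m n h hn l hl
      · have := hlt n m h hm (-l) (neg_mem hl)
        rwa [← norm_neg, show -(y m - y n - -l) = y n - y m - l by ring] at this
    have hinj : Set.InjOn y (Finset.range N) := by
      intro m hm n hn hmn
      by_contra hne
      have := hsep m n hne (Finset.mem_range.1 hm) (Finset.mem_range.1 hn) 0 (zero_mem _)
      rw [hmn, sub_self, sub_zero, norm_zero] at this
      linarith
    have hcard := hcount ρ hρ0 ?_ ((Finset.range N).image y) ?_ ?_
    · rw [Finset.card_image_of_injOn hinj, Finset.card_range, hρ,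
        Real.rpow_neg (by positivity), Real.inv_rpow (by positivity), inv_inv,
        Real.mul_rpow (by positivity) hγ0.le] at hcard
      have h1 := (div_le_iff₀ hC).1 ((Nat.le_ceil _).trans hcard)
      have h2 : ‖(γ : ℂ)‖ ^ (1 - (t : ℝ)) ≤ C * (A * (2 * ‖(q : ℂ)‖) ^ (t : ℝ)) := by
        rw [Real.rpow_sub hγ0, Real.rpow_one, div_le_iff₀ (by positivity)]
        linarith
      rw [hM]
      exact (Real.le_rpow_inv_iff_of_pos hγ0.le (by positivity) (by linarith)).2 h2
    · rw [hρ, inv_le_comm₀ (by positivity) (by positivity)]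
      rw [inv_div, div_inv_eq_mul]
      nlinarith
    · intro z hz
      obtain ⟨n, _, rfl⟩ := Finset.mem_image.1 (Finset.mem_coe.1 hz)
      exact hyK n
    · intro z hz w hw hne l hl
      obtain ⟨n, hn, rfl⟩ := Finset.mem_image.1 hz
      obtain ⟨m, hm, rfl⟩ := Finset.mem_image.1 hw
      exact hsep m n (fun h => hne (h ▸ rfl)) (Finset.mem_range.1 hm) (Finset.mem_range.1 hn) l hl
  obtain ⟨R, hR⟩ := hKc.isBounded.exists_norm_le
  refine ((GaussianInt.finite_norm_le (R * M)).image2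
    (fun ω γ : GaussianInt => (ω : ℂ) / (γ : ℂ)) (GaussianInt.finite_norm_le M)).subset ?_
  rintro z ⟨hzK, hz⟩
  obtain ⟨ω, γ, hγ, hγS, hω, rfl⟩ := exists_coprime_of_mem_gaussianRationalsWithDenomIn hz
  have hγM := hden ω γ hγ hγS hω hzK
  have hγ0 : 0 < ‖(γ : ℂ)‖ := one_pos.trans_le (GaussianInt.one_le_norm hγ)
  have hzR := hR _ hzK
  refine ⟨ω, ?_, γ, hγM, rfl⟩
  have hR0 : 0 ≤ R := (norm_nonneg _).trans hzR
  rw [norm_div, div_le_iff₀ hγ0] at hzR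
  exact hzR.trans (by gcongr)
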